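/- Let $K$ be an algebraically closed field of characteristic $0$, let $r$ be a non-negative integer and $R=K[x_1,\dots,x_r]$. For a homogeneous ideal $I\subset R$ and $t\in\mathbb Z$ write $H_{R/I}(t)=\dim_K[R/I]_t$ (which is $0$ for $t<0$). Let $\ell,\ell_1,\dots,\ell_{r+1}$ be general linear forms and $q_1,\dots,q_{r+1}$ general forms of degree $2$ in $R$, and set \[A=R/(x_1^2,\dots,x_r^2,\ell^2),\qquad B=R/(\ell_1^2,\dots,\ell_{r+1}^2),\qquad C=R/(q_1,\dots,q_{r+1}).\] Then $A$, $B$ and $C$ are artinian and \[H_A(t)=H_B(t)=H_C(t)=\max\left\{\binom{r}{t}-\binom{r}{t-2},\,0\right\}\qquad\text{for all } t\in\mathbb Z,\] where $\binom{r}{j}=0$ for $j<0$ and for $j>r$. Here "general" means that there are non-empty Zariski open subsets $U_A$, $U_B$, $U_C$ of the affine spaces $R_1$, $R_1^{r+1}$, $R_2^{r+1}$ (where $R_d$ is the space of forms of degree $d$) such that the assertion holds, for all $t$ at once, whenever $\ell\in U_A$, $(\ell_1,\dots,\ell_{r+1})\in U_B$ and $(q_1,\dots,q_{r+1})\in U_C$.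 -/

import Mathlib

open MvPolynomial

namespace GeneralForms

/-- The `K`-vector space of forms of degree `d` in `K[x_1, …, x_r]`. -/
abbrev Form (K : Type*) [Field K] (r d : ℕ) : Type _ :=
  homogeneousSubmodule (Fin r) K d

/-- The coefficients of an `s`-tuple of forms. Those at exponents of degree `d` are the affine
coordinates of the space of `s`-tuples of forms of degree `d`; all others are identically zero. -/
def coords {K : Type*} [Field K] {r d s : ℕ} (f : Fin s → Form K r d) :
    Fin s × (Fin r →₀ ℕ) → K :=
  fun p => coeff p.2 (f p.1 : MvPolynomial (Fin r) K)

/-- Zariski open subsets of the affine space of `s`-tuples of forms of degree `d`: the sets of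
tuples at which not all members of some family of polynomials in the coefficients vanish. -/
def IsZariskiOpen {K : Type*} [Field K] {r d s : ℕ} (U : Set (Fin s → Form K r d)) : Prop :=
  ∃ S : Set (MvPolynomial (Fin s × (Fin r →₀ ℕ)) K),
    U = {f | ∃ D ∈ S, eval (coords f) D ≠ 0}

/-- The graded component `[R/I]_t` of `R/I` (for a homogeneous ideal `I` of `R = K[x_1, …, x_r]`):
the image in `R/I` of the space of forms of degree `t`. -/
noncomputable def gradedComponent {K : Type*} [Field K] {r : ℕ}
    (I : Ideal (MvPolynomial (Fin r) K)) (t : ℕ) :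
    Submodule K (MvPolynomial (Fin r) K ⧸ I) :=
  (homogeneousSubmodule (Fin r) K t).map (Ideal.Quotient.mkₐ K I).toLinearMap

/-- The Hilbert function `ℤ → ℤ` of `R/I`, which is zero in negative degrees. -/
noncomputable def hilbertFunction {K : Type*} [Field K] {r : ℕ}
    (I : Ideal (MvPolynomial (Fin r) K)) (t : ℤ) : ℤ :=
  if 0 ≤ t then (Module.finrank K (gradedComponent I t.toNat) : ℤ) else 0

/-- The binomial coefficient `binom(r, t)` for an integer `t`, which is zero for `t < 0`. -/
def binom (r : ℕ) (t : ℤ) : ℤ :=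
  if 0 ≤ t then (r.choose t.toNat : ℤ) else 0

/-- The ideal `(x_1², …, x_r², ℓ²)`. -/
noncomputable def idealA {K : Type*} [Field K] {r : ℕ} (l : Form K r 1) : Ideal (MvPolynomial (Fin r) K) :=
  Ideal.span (Set.range (fun i : Fin r => (X i : MvPolynomial (Fin r) K) ^ 2) ∪
    {(l : MvPolynomial (Fin r) K) ^ 2})

/-- The ideal `(ℓ_1², …, ℓ_s²)`. -/
noncomputable def idealB {K : Type*} [Field K] {r s : ℕ} (l : Fin s → Form K r 1) :
    Ideal (MvPolynomial (Fin r) K) :=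
  Ideal.span (Set.range fun i => (l i : MvPolynomial (Fin r) K) ^ 2)

/-- The ideal `(q_1, …, q_s)`. -/
noncomputable def idealC {K : Type*} [Field K] {r s : ℕ} (q : Fin s → Form K r 2) :
    Ideal (MvPolynomial (Fin r) K) :=
  Ideal.span (Set.range fun i => (q i : MvPolynomial (Fin r) K))

end GeneralForms

/-!
The three algebras are compared with one special point of the space of `r + 1` quadrics, namely
`(x_1², …, x_r², (x_1 + ⋯ + x_r)²)`, which occurs in each of the three families. Writing
`h(t) = max (binom r t - binom r (t - 2)) 0`, it suffices to show that the Hilbert function of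
`r + 1` quadrics is at most `h` near the special point and at least `h` generically. There are only
finitely many conditions, since `h(r + 1) = 0` forces all forms of degree at least `r + 1` into the
ideal, which also gives that the quotient is artinian.

*Upper bound.* The dimension of the space of forms of degree `t` in the ideal is lower
semicontinuous (`exists_finrank_formsIn_le_of_ne_zero`), so the bound is needed only at the special
point. There it is the strong Lefschetz property of `K[x_1, …, x_r]/(x_1², …, x_r²)`: multiplication
by `(x_1 + ⋯ + x_r)²` has maximal rank in each degree. With the squarefree algebra realised as the
functions on the subsets of `{1, …, r}`, this follows from the commutation relation of `sl₂` between
multiplication by `x_1 + ⋯ + x_r` and the sum of the partial derivatives of squarefree monomials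
(`eq_zero_of_up_pow_eq_zero`, `level_le_map_up_pow`).

*Lower bound.* For quadrics `q_1, …, q_r` the products `∏ x_i^{a_i mod 2} q_i^{⌊a_i / 2⌋}` with
`|a| = t` are as many as the monomials of degree `t`, and equal to them at the special point; so
generically they form a basis of the space of forms of degree `t`. Those with `a` not squarefree
span the degree `t` part of `(q_1, …, q_r)`, whose codimension is therefore `binom r t`, and one
more quadric adds at most the `binom r (t - 2)` products of it with squarefree monomials
(`formsIn_le_span_sup_span`). This replaces any appeal to regular sequences.

Openness of all conditions comes from one fact: linear independence of finitely many polynomials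
depending on parameters is witnessed by a nonvanishing determinant
(`exists_linearIndependent_of_ne_zero`).
-/

/-! ### The strong Lefschetz property of the squarefree algebra -/

namespace BooleanLattice

variable {K : Type*} [Field K] {r : ℕ}

/-- Multiplication by `x_i` on the algebra `K[x_1, …, x_r]/(x_1², …, x_r²)`, an element of which is
encoded by the function sending `S` to the coefficient of the squarefree monomial `∏_{i ∈ S} x_i`. -/
def raise (i : Fin r) : (Finset (Fin r) → K) →ₗ[K] (Finset (Fin r) → K) where
  toFun f S := if i ∈ S then f (S.erase i) else 0
  map_add' f g := by ext S; by_cases h : i ∈ S <;> simp [h]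
  map_smul' c f := by ext S; by_cases h : i ∈ S <;> simp [h]

/-- The linear map sending each squarefree monomial to its partial derivative with respect to `x_i`,
in the encoding of `raise`. It is not a derivation of the squarefree algebra. -/
def lower (i : Fin r) : (Finset (Fin r) → K) →ₗ[K] (Finset (Fin r) → K) where
  toFun f S := if i ∈ S then 0 else f (insert i S)
  map_add' f g := by ext S; by_cases h : i ∈ S <;> simp [h]
  map_smul' c f := by ext S; by_cases h : i ∈ S <;> simp [h]

/-- Multiplication by `x_1 + ⋯ + x_r` on the squarefree algebra. -/
def up : (Finset (Fin r) → K) →ₗ[K] (Finset (Fin r) → K) := ∑ i, raise i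

/-- The sum of the partial derivatives of squarefree monomials; with `up` it generates an action
of `sl₂`. -/
def down : (Finset (Fin r) → K) →ₗ[K] (Finset (Fin r) → K) := ∑ i, lower i

/-- The homogeneous elements of degree `k` of the squarefree algebra: functions supported on the
`k`-element sets. -/
def level (K : Type*) [Field K] (r k : ℕ) : Submodule K (Finset (Fin r) → K) where
  carrier := {f | ∀ S : Finset (Fin r), S.card ≠ k → f S = 0}
  add_mem' hf hg S hS := by simp [hf S hS, hg S hS]
  zero_mem' S hS := rfl
  smul_mem' c f hf S hS := by simp [hf S hS]

lemma up_apply (f : Finset (Fin r) → K) (S : Finset (Fin r)) :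
    up f S = ∑ i, if i ∈ S then f (S.erase i) else 0 := by
  simp [up, raise]

lemma down_apply (f : Finset (Fin r) → K) (S : Finset (Fin r)) :
    down f S = ∑ i, if i ∈ S then 0 else f (insert i S) := by
  simp [down, lower]

lemma up_mem_level {k : ℕ} {f : Finset (Fin r) → K} (hf : f ∈ level K r k) :
    up f ∈ level K r (k + 1) := by
  intro S hS
  rw [up_apply]
  refine Finset.sum_eq_zero fun i _ => ?_
  split_ifs with hi
  · refine hf _ fun h => hS ?_
    rw [← h, Finset.card_erase_add_one hi]
  · rfl

lemma down_mem_level {k : ℕ} {f : Finset (Fin r) → K} (hf : f ∈ level K r (k + 1)) :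
    down f ∈ level K r k := by
  intro S hS
  rw [down_apply]
  refine Finset.sum_eq_zero fun i _ => ?_
  split_ifs with hi
  · rfl
  · exact hf _ (by rw [Finset.card_insert_of_notMem hi]; omega)

lemma down_eq_zero {f : Finset (Fin r) → K} (hf : f ∈ level K r 0) : down f = 0 := by
  ext S
  rw [down_apply]
  refine Finset.sum_eq_zero fun i _ => ?_
  split_ifs with hi
  · rfl
  · exact hf _ (by simp)

lemma lower_raise_of_ne {i j : Fin r} (h : i ≠ j) (f : Finset (Fin r) → K) :
    lower i (raise j f) = raise j (lower i f) := by
  ext S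
  by_cases hi : i ∈ S <;> by_cases hj : j ∈ S <;>
    simp [lower, raise, hi, hj, h, h.symm, Finset.erase_insert_of_ne]

lemma lower_raise_self (i : Fin r) (f : Finset (Fin r) → K) (S : Finset (Fin r)) :
    lower i (raise i f) S = raise i (lower i f) S + (if i ∈ S then -f S else f S) := by
  by_cases hi : i ∈ S <;> simp [lower, raise, hi]

lemma down_up {k : ℕ} {f : Finset (Fin r) → K} (hf : f ∈ level K r k) :
    down (up f) = up (down f) + ((r : K) - 2 * k) • f := by
  ext S
  have h1 : down (up f) = ∑ i, ∑ j, lower i (raise j f) := by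
    rw [Finset.sum_comm]; simp [down, up]
  have h2 : up (down f) = ∑ i, ∑ j, raise j (lower i f) := by
    simp only [down, up, LinearMap.sum_apply, map_sum]
  have h3 : ∀ i j, lower i (raise j f) S = raise j (lower i f) S +
      if i = j then (if i ∈ S then -f S else f S) else 0 := by
    intro i j
    split_ifs with h h'
    · subst h; simp [lower_raise_self, h']
    · subst h; simp [lower_raise_self, h']
    · rw [lower_raise_of_ne h, add_zero]
  rw [h1, h2]
  simp only [Finset.sum_apply, Pi.add_apply, Pi.smul_apply, h3, Finset.sum_add_distrib,
    Finset.sum_ite_eq, Finset.mem_univ, if_true, smul_eq_mul]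
  congr 1
  -- Each `i ∉ S` contributes `f S` and each `i ∈ S` contributes `-f S`.
  by_cases hS : S.card = k
  · have h4 : ∀ i : Fin r, (if i ∈ S then -f S else f S) = f S - 2 * (if i ∈ S then f S else 0) := by
      intro i; split_ifs <;> ring
    simp only [h4, Finset.sum_sub_distrib, ← Finset.mul_sum, Finset.sum_ite_mem]
    simp [hS]; ring
  · simp [hf S hS]

lemma up_up_pow (j : ℕ) (f : Finset (Fin r) → K) : up ((up ^ j) f) = (up ^ (j + 1)) f := by
  rw [pow_succ', Module.End.mul_apply]

lemma up_pow_mem_level {k : ℕ} {f : Finset (Fin r) → K} (hf : f ∈ level K r k) (j : ℕ) :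
    (up ^ j) f ∈ level K r (k + j) := by
  induction j with
  | zero => simpa using hf
  | succ j ih =>
    rw [← up_up_pow, ← add_assoc]
    exact up_mem_level ih

lemma down_up_pow {k : ℕ} {f : Finset (Fin r) → K} (hf : f ∈ level K r k) (j : ℕ) :
    down ((up ^ (j + 1)) f) = (up ^ (j + 1)) (down f) +
      (((j : K) + 1) * ((r : K) - 2 * k - j)) • (up ^ j) f := by
  induction j with
  | zero => simp [down_up hf]
  | succ j ih =>
    rw [← up_up_pow (j + 1), down_up (up_pow_mem_level hf (j + 1)), ih,
      map_add, map_smul, up_up_pow, up_up_pow, add_assoc, ← add_smul]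
    congr 2
    push_cast
    ring

lemma eq_zero_of_down_eq_zero [CharZero K] {k j : ℕ} {f : Finset (Fin r) → K}
    (hf : f ∈ level K r k) (hkj : 2 * k + j ≤ r) (hd : down f = 0) (h : (up ^ j) f = 0) :
    f = 0 := by
  induction j with
  | zero => simpa using h
  | succ j ih =>
    refine ih (by omega) ?_
    have h0 := down_up_pow hf j
    rw [h, hd, map_zero, map_zero, zero_add, eq_comm, smul_eq_zero] at h0
    refine h0.resolve_left (mul_ne_zero (Nat.cast_add_one_ne_zero j) fun h1 => ?_)
    have h2 : ((2 * k + j : ℕ) : K) ≠ r := Nat.cast_injective.ne (by omega)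
    push_cast at h2
    exact h2 (by linear_combination -h1)

/-- Injectivity in the strong Lefschetz property of the squarefree algebra. If `up ^ j` kills `f`,
then `up ^ (j + 1)` kills `down f`, so `down f = 0` by induction on the degree; by the `sl₂`
relation, `up ^ (j - 1)` then kills `f` too. -/
theorem eq_zero_of_up_pow_eq_zero [CharZero K] {k j : ℕ} {f : Finset (Fin r) → K}
    (hf : f ∈ level K r k) (hkj : 2 * k + j ≤ r) (h : (up ^ j) f = 0) : f = 0 := by
  induction k generalizing j f with
  | zero => exact eq_zero_of_down_eq_zero hf hkj (down_eq_zero hf) h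
  | succ k ihk =>
    refine eq_zero_of_down_eq_zero hf hkj
      (ihk (j := j + 1) (down_mem_level hf) (by omega) ?_) h
    cases j with
    | zero => simp_all
    | succ j =>
      have := congrArg up (down_up_pow hf j)
      rw [h, map_zero, map_zero, map_add, map_smul, up_up_pow, up_up_pow, h, smul_zero,
        add_zero] at this
      exact this.symm

lemma finrank_level (K : Type*) [Field K] (r k : ℕ) :
    Module.finrank K (level K r k) = r.choose k := by
  let e : level K r k ≃ₗ[K] ({S : Finset (Fin r) // S.card = k} → K) :=
    { toFun := fun f S => f.1 S.1
      map_add' := fun f g => rfl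
      map_smul' := fun c f => rfl
      invFun := fun g => ⟨fun S => if h : S.card = k then g ⟨S, h⟩ else 0, fun S hS => dif_neg hS⟩
      left_inv := fun f => by
        ext S
        by_cases h : S.card = k
        · simp [h]
        · simp [h, f.2 S h]
      right_inv := fun g => by
        ext S
        simp [S.2] }
  rw [e.finrank_eq, Module.finrank_fintype_fun_eq_card, Fintype.card_finset_len, Fintype.card_fin]

lemma finrank_map_up_pow [CharZero K] {k j : ℕ} (hkj : 2 * k + j ≤ r) :
    Module.finrank K ((level K r k).map (up ^ j)) = r.choose k := by
  rw [← finrank_level K r k]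
  refine LinearEquiv.finrank_eq (LinearEquiv.symm ?_)
  refine LinearEquiv.ofBijective ((up ^ j).submoduleMap (level K r k)) ⟨?_, ?_⟩
  · rw [← LinearMap.ker_eq_bot, LinearMap.ker_eq_bot']
    intro f hf
    exact Subtype.ext (eq_zero_of_up_pow_eq_zero f.2 hkj (congrArg Subtype.val hf))
  · exact LinearMap.submoduleMap_surjective _ _

/-- Surjectivity in the strong Lefschetz property: `up ^ (k + j - k')` with `k' = r - k - j` is
injective from level `k'` to level `k + j`, two levels of the same dimension, and it factors through
`up ^ j`. -/
theorem level_le_map_up_pow [CharZero K] {k j : ℕ} (hkj : r ≤ 2 * k + j) :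
    level K r (k + j) ≤ (level K r k).map (up ^ j) := by
  by_cases ht : r < k + j
  · have : level K r (k + j) = ⊥ := by
      rw [← Submodule.finrank_eq_zero (R := K), finrank_level, Nat.choose_eq_zero_of_lt ht]
    rw [this]; exact bot_le
  obtain ⟨k', hk'⟩ : ∃ k', r = k' + (k + j) := ⟨r - (k + j), by omega⟩
  obtain ⟨i, hi⟩ : ∃ i, k = k' + i := ⟨k - k', by omega⟩
  have h1 : (level K r k').map (up ^ (j + i)) = level K r (k + j) := by
    refine Submodule.eq_of_le_of_finrank_eq ?_ ?_
    · rintro _ ⟨f, hf, rfl⟩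
      have := up_pow_mem_level hf (j + i)
      rwa [show k' + (j + i) = k + j by omega] at this
    · rw [finrank_map_up_pow (by omega), finrank_level, hk', Nat.choose_symm_add]
  rw [← h1]
  rintro _ ⟨f, hf, rfl⟩
  refine ⟨(up ^ i) f, ?_, ?_⟩
  · rw [hi]; exact up_pow_mem_level hf i
  · rw [pow_add, Module.End.mul_apply]

end BooleanLattice

namespace GeneralForms

/-! ### Graded pieces of ideals and quotients -/

section GradedPieces

variable {K : Type*} [Field K]

lemma finrank_map_add_finrank_inf_ker {V W : Type*} [AddCommGroup V] [Module K V]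
    [AddCommGroup W] [Module K W] (f : V →ₗ[K] W) (p : Submodule K V) [FiniteDimensional K p] :
    Module.finrank K (p.map f) + Module.finrank K (p ⊓ LinearMap.ker f : Submodule K V) =
      Module.finrank K p := by
  rw [← LinearMap.finrank_range_add_finrank_ker (f.domRestrict p), LinearMap.range_domRestrict,
    LinearMap.ker_domRestrict, ← Submodule.finrank_map_subtype_eq p ((LinearMap.ker f).comap _),
    Submodule.map_comap_subtype]

variable {r : ℕ}

instance (t : ℕ) : FiniteDimensional K (homogeneousSubmodule (Fin r) K t) :=
  Module.Finite.iff_fg.2 (homogeneousSubmodule_fg _ _ t)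

/-- The space of forms of degree `t` in an ideal. -/
noncomputable def formsIn (I : Ideal (MvPolynomial (Fin r) K)) (t : ℕ) :
    Submodule K (MvPolynomial (Fin r) K) :=
  homogeneousSubmodule (Fin r) K t ⊓ I.restrictScalars K

instance (I : Ideal (MvPolynomial (Fin r) K)) (t : ℕ) : FiniteDimensional K (formsIn I t) :=
  Submodule.finiteDimensional_inf_left _ _

lemma restrictScalars_eq_ker_mk (I : Ideal (MvPolynomial (Fin r) K)) :
    I.restrictScalars K = LinearMap.ker (Ideal.Quotient.mkₐ K I).toLinearMap := by
  ext f
  simp [Ideal.Quotient.eq_zero_iff_mem]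

lemma finrank_gradedComponent_add (I : Ideal (MvPolynomial (Fin r) K)) (t : ℕ) :
    Module.finrank K (gradedComponent I t) + Module.finrank K (formsIn I t) =
      Module.finrank K (homogeneousSubmodule (Fin r) K t) := by
  rw [← finrank_map_add_finrank_inf_ker (Ideal.Quotient.mkₐ K I).toLinearMap
    (homogeneousSubmodule (Fin r) K t), ← restrictScalars_eq_ker_mk]
  rfl

end GradedPieces

/-! ### The special point -/

section SpecialPoint

open BooleanLattice

variable {K : Type*} [Field K] {r : ℕ}

/-- The exponent of the squarefree monomial `∏_{i ∈ S} x_i`. -/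
noncomputable def squarefreeExponent (S : Finset (Fin r)) : Fin r →₀ ℕ :=
  Finsupp.equivFunOnFinite.symm fun i => if i ∈ S then 1 else 0

@[simp]
lemma squarefreeExponent_apply (S : Finset (Fin r)) (i : Fin r) :
    squarefreeExponent S i = if i ∈ S then 1 else 0 := rfl

lemma degree_squarefreeExponent (S : Finset (Fin r)) : (squarefreeExponent S).degree = S.card := by
  simp [Finsupp.degree_eq_sum]

lemma squarefreeExponent_injective :
    Function.Injective (squarefreeExponent : Finset (Fin r) → Fin r →₀ ℕ) := by
  intro S T h
  ext i
  have := DFunLike.congr_fun h i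
  simp only [squarefreeExponent_apply] at this
  by_cases hS : i ∈ S <;> by_cases hT : i ∈ T <;> simp [hS, hT] at this ⊢

lemma exists_squarefreeExponent_eq {a : Fin r →₀ ℕ} (ha : ∀ i, a i ≤ 1) :
    ∃ S, squarefreeExponent S = a := by
  refine ⟨a.support, Finsupp.ext fun i => ?_⟩
  have := ha i
  simp only [squarefreeExponent_apply, Finsupp.mem_support_iff]
  split_ifs with h <;> omega

/-- The coefficients of a polynomial at the squarefree monomials, that is, its class modulo
`(x_1², …, x_r²)`. -/
noncomputable def squarefreePart : MvPolynomial (Fin r) K →ₗ[K] (Finset (Fin r) → K) :=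
  LinearMap.pi fun S => lcoeff K (squarefreeExponent S)

@[simp]
lemma squarefreePart_apply (f : MvPolynomial (Fin r) K) (S : Finset (Fin r)) :
    squarefreePart f S = coeff (squarefreeExponent S) f := rfl

lemma squarefreePart_X_mul (i : Fin r) (f : MvPolynomial (Fin r) K) :
    squarefreePart (X i * f) = raise i (squarefreePart f) := by
  ext S
  have h : (i ∈ (squarefreeExponent S).support) ↔ i ∈ S := by simp
  simp only [squarefreePart_apply, coeff_X_mul', h, raise, LinearMap.coe_mk, AddHom.coe_mk]
  refine if_congr Iff.rfl (congrArg (fun a => coeff a f) (Finsupp.ext fun j => ?_)) rfl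
  by_cases hj : j = i
  · subst hj; by_cases hS : j ∈ S <;> simp [hS]
  · simp [hj]

lemma squarefreePart_sum_X_sq_mul (f : MvPolynomial (Fin r) K) :
    squarefreePart ((∑ i, X i) ^ 2 * f) = (up ^ 2) (squarefreePart f) := by
  have h (g : MvPolynomial (Fin r) K) : squarefreePart ((∑ i, X i) * g) = up (squarefreePart g) := by
    simp [Finset.sum_mul, map_sum, squarefreePart_X_mul, up]
  rw [pow_two, mul_assoc, h, h, pow_two, Module.End.mul_apply]

lemma map_squarefreePart (t : ℕ) :
    (homogeneousSubmodule (Fin r) K t).map squarefreePart = level K r t := by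
  apply le_antisymm
  · rintro _ ⟨f, hf, rfl⟩ S hS
    exact IsHomogeneous.coeff_eq_zero hf (by rwa [degree_squarefreeExponent])
  · intro g hg
    refine ⟨∑ S, monomial (squarefreeExponent S) (g S), ?_, ?_⟩
    · refine Submodule.sum_mem _ fun S _ => ?_
      by_cases hS : S.card = t
      · exact isHomogeneous_monomial _ (by rw [degree_squarefreeExponent, hS])
      · rw [hg S hS, map_zero]; exact Submodule.zero_mem _
    · ext S
      rw [squarefreePart_apply, coeff_sum]
      simp [coeff_monomial, squarefreeExponent_injective.eq_iff]

/-- The point `(x_1², …, x_r², (x_1 + ⋯ + x_r)²)` of the space of `r + 1` quadrics, at which the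
generic conditions are checked. -/
noncomputable def specialQuadrics (K : Type*) [Field K] (r : ℕ) :
    Fin (r + 1) → MvPolynomial (Fin r) K :=
  Fin.snoc (fun i => X i ^ 2) ((∑ i, X i) ^ 2)

lemma ker_squarefreePart_le :
    LinearMap.ker (squarefreePart (K := K) (r := r)) ≤
      (Ideal.span (Set.range (specialQuadrics K r))).restrictScalars K := by
  intro f hf
  rw [Submodule.restrictScalars_mem, f.as_sum]
  refine Ideal.sum_mem _ fun a ha => ?_
  have : ∃ i, 2 ≤ a i := by
    by_contra! h
    obtain ⟨S, rfl⟩ := exists_squarefreeExponent_eq fun i => Nat.le_of_lt_succ (h i)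
    exact mem_support_iff.1 ha (congrFun hf S)
  obtain ⟨i, hi⟩ := this
  have hX : (X i ^ 2 : MvPolynomial (Fin r) K) ∈ Ideal.span (Set.range (specialQuadrics K r)) :=
    Ideal.subset_span ⟨i.castSucc, by simp [specialQuadrics]⟩
  refine Ideal.mem_of_dvd _ ?_ hX
  rw [X_pow_eq_monomial, monomial_dvd_monomial]
  exact ⟨Or.inr (by simpa using hi), one_dvd _⟩

lemma map_up_sq_le (s : ℕ) :
    (level K r s).map (up ^ 2) ≤
      (formsIn (Ideal.span (Set.range (specialQuadrics K r))) (s + 2)).map squarefreePart := by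
  rw [← map_squarefreePart]
  rintro _ ⟨_, ⟨f, hf, rfl⟩, rfl⟩
  refine ⟨(∑ i, X i) ^ 2 * f, ⟨?_, ?_⟩, squarefreePart_sum_X_sq_mul f⟩
  · rw [add_comm]
    exact ((IsHomogeneous.sum _ _ 1 fun i _ => isHomogeneous_X K i).pow 2).mul hf
  · exact Ideal.mul_mem_right _ _ (Ideal.subset_span ⟨Fin.last r, by simp [specialQuadrics]⟩)

/-- At the special point the ideal is as large as the strong Lefschetz property makes it. -/
theorem finrank_le_finrank_formsIn_specialQuadrics [CharZero K] (t : ℕ) :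
    (Module.finrank K (homogeneousSubmodule (Fin r) K t) : ℤ) ≤
      Module.finrank K (formsIn (Ideal.span (Set.range (specialQuadrics K r))) t) +
        max (binom r t - binom r (t - 2)) 0 := by
  set J := formsIn (Ideal.span (Set.range (specialQuadrics K r))) t with hJ
  have h1 := finrank_map_add_finrank_inf_ker (squarefreePart (K := K) (r := r))
    (homogeneousSubmodule (Fin r) K t)
  have h2 := finrank_map_add_finrank_inf_ker (squarefreePart (K := K) (r := r)) J
  have h3 : (J ⊓ LinearMap.ker squarefreePart : Submodule K _) =
      homogeneousSubmodule (Fin r) K t ⊓ LinearMap.ker squarefreePart := by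
    rw [hJ, formsIn, inf_assoc, inf_eq_right.2 ker_squarefreePart_le]
  rw [map_squarefreePart, finrank_level] at h1
  rw [h3] at h2
  have hb : binom r t = r.choose t := by simp [binom]
  rw [hb]
  by_cases ht : t < 2
  · have : binom r ((t : ℤ) - 2) = 0 := if_neg (by omega)
    rw [this]
    have := le_max_left ((r.choose t : ℤ) - 0) 0
    omega
  obtain ⟨s, rfl⟩ := Nat.exists_eq_add_of_le' (not_lt.1 ht)
  have hb' : binom r (((s + 2 : ℕ) : ℤ) - 2) = r.choose s := by
    rw [show ((s + 2 : ℕ) : ℤ) - 2 = s by push_cast; ring]; simp [binom]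
  rw [hb']
  have h4 := Submodule.finrank_mono (map_up_sq_le (K := K) (r := r) s)
  rw [← hJ] at h4
  -- Below the middle degree `up ^ 2` is injective, so the image has dimension `binom r s`; above it,
  -- `up ^ 2` is onto, so the ideal contains all forms of degree `s + 2`.
  rcases le_total (2 * s + 2) r with h | h
  · rw [finrank_map_up_pow h] at h4
    have := le_max_left ((r.choose (s + 2) : ℤ) - r.choose s) 0
    omega
  · have h5 := Submodule.finrank_mono (level_le_map_up_pow (K := K) h)
    rw [finrank_level] at h5
    have := le_max_right ((r.choose (s + 2) : ℤ) - r.choose s) 0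
    omega

end SpecialPoint

/-! ### Open conditions -/

section Openness

variable {K : Type*} [Field K] {A : Type*} [CommRing A] [Algebra K A] {σ ι : Type*}

/-- Linear independence is an open condition on a finite family of polynomials whose coefficients
depend on parameters: a linear map sending the members at one point to the standard basis vectors
has, along the whole family, a matrix whose determinant is nonzero at that point. -/
theorem exists_linearIndependent_of_ne_zero [Finite ι] (F : ι → MvPolynomial σ A) (φ₀ : A →ₐ[K] K)
    (h : LinearIndependent K fun j => map (φ₀ : A →+* K) (F j)) :
    ∃ D : A, φ₀ D ≠ 0 ∧ ∀ φ : A →ₐ[K] K, φ D ≠ 0 →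
      LinearIndependent K fun j => map (φ : A →+* K) (F j) := by
  classical
  have := Fintype.ofFinite ι
  obtain ⟨g, hg⟩ := (Finsupp.linearCombination K
    fun j => map (φ₀ : A →+* K) (F j)).exists_leftInverse_of_injective (LinearMap.ker_eq_bot.2 h)
  -- The matrix of `g` on the family: `g` is defined over `K` only, so it is extended to coefficients
  -- in `A` through its values on monomials.
  let M : Matrix ι ι A := Matrix.of fun i j =>
    ∑ b ∈ (F i).support, coeff b (F i) * algebraMap K A (g (monomial b 1) j)
  have hM (φ : A →ₐ[K] K) : M.map φ = Matrix.of fun i j => g (map (φ : A →+* K) (F i)) j := by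
    ext i j
    rw [Matrix.of_apply]
    conv_rhs => rw [(F i).as_sum]
    simp only [M, Matrix.map_apply, Matrix.of_apply, map_sum, map_mul, AlgHom.commutes,
      map_monomial, Finsupp.finsetSum_apply, Algebra.algebraMap_self, RingHom.id_apply]
    refine Finset.sum_congr rfl fun b _ => ?_
    conv_rhs => rw [← mul_one ((φ : A →+* K) (coeff b (F i))), ← smul_eq_mul, ← smul_monomial,
      map_smul]
    rfl
  refine ⟨M.det, ?_, fun φ hφ => ?_⟩
  · have h1 : M.map φ₀ = 1 := by
      rw [hM]
      ext i j
      have := DFunLike.congr_fun (LinearMap.congr_fun hg (Finsupp.single i 1)) j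
      simpa [Matrix.one_apply, Finsupp.single_apply] using this
    rw [AlgHom.map_det, AlgHom.mapMatrix_apply, h1, Matrix.det_one]
    exact one_ne_zero
  · rw [AlgHom.map_det, AlgHom.mapMatrix_apply, hM] at hφ
    have hrow := Matrix.linearIndependent_rows_of_det_ne_zero hφ
    exact LinearIndependent.of_comp (Finsupp.lcoeFun ∘ₗ g) hrow

end Openness

/-! ### Forms in ideals generated by quadrics -/

section Ideals

variable {K : Type*} [Field K] {r s : ℕ}

attribute [local instance] MvPolynomial.gradedAlgebra

lemma homogeneousComponent_mem_span {q : Fin s → MvPolynomial (Fin r) K}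
    (hq : ∀ i, (q i).IsHomogeneous 2) {f : MvPolynomial (Fin r) K}
    (hf : f ∈ Ideal.span (Set.range q)) (t : ℕ) :
    homogeneousComponent t f ∈ Ideal.span (Set.range q) := by
  refine homogeneousComponent_mem_of_mem (Ideal.homogeneous_span _ _ ?_) hf t
  rintro _ ⟨i, rfl⟩
  exact ⟨2, hq i⟩

lemma map_homogeneousComponent {A B : Type*} [CommRing A] [CommRing B] (φ : A →+* B) (t : ℕ)
    (f : MvPolynomial (Fin r) A) :
    map φ (homogeneousComponent t f) = homogeneousComponent t (map φ f) := by
  ext a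
  simp only [coeff_map, coeff_homogeneousComponent]
  split_ifs <;> simp

/-- A form of degree `t` in the ideal generated by quadrics is a combination of them with
coefficients of degree `t - 2`, and vanishes for `t < 2`. -/
lemma exists_eq_sum_of_mem_formsIn {q : Fin s → MvPolynomial (Fin r) K}
    (hq : ∀ i, (q i).IsHomogeneous 2) {t : ℕ} {f : MvPolynomial (Fin r) K}
    (hf : f ∈ formsIn (Ideal.span (Set.range q)) t) :
    ∃ c : Fin s → MvPolynomial (Fin r) K,
      (∀ i, c i = 0 ∨ ∃ u, u + 2 = t ∧ (c i).IsHomogeneous u) ∧ f = ∑ i, c i * q i := by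
  obtain ⟨hf, hfI⟩ := hf
  obtain ⟨c, hc⟩ := (Ideal.mem_span_range_iff_exists_fun).1 hfI
  have key (i : Fin s) : homogeneousComponent t (c i * q i) =
      (if 2 ≤ t then homogeneousComponent (t - 2) (c i) else 0) * q i := by
    have hdec (g : MvPolynomial (Fin r) K) (n : ℕ) : homogeneousComponent n g =
        DirectSum.decompose (homogeneousSubmodule (Fin r) K) g n :=
      (decomposition.decompose'_apply g n).symm
    rw [hdec, hdec, DirectSum.coe_decompose_mul_of_right_mem _ t (hq i), ite_mul, zero_mul]
  refine ⟨fun i => if 2 ≤ t then homogeneousComponent (t - 2) (c i) else 0, fun i => ?_, ?_⟩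
  · by_cases ht : 2 ≤ t
    · exact Or.inr ⟨t - 2, by omega, by simpa [ht] using homogeneousComponent_isHomogeneous _ _⟩
    · exact Or.inl (by simp [ht])
  · rw [← homogeneousComponent_eq_self hf, ← hc, map_sum]
    exact Finset.sum_congr rfl fun i _ => key i

/-- The dimension of the space of forms of degree `t` in an ideal generated by quadrics does not
drop on a neighbourhood of a given point. -/
theorem exists_finrank_formsIn_le_of_ne_zero {A : Type*} [CommRing A] [Algebra K A]
    {Q : Fin s → MvPolynomial (Fin r) A} (hQ : ∀ i, (Q i).IsHomogeneous 2) (φ₀ : A →ₐ[K] K)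
    (t : ℕ) :
    ∃ D : A, φ₀ D ≠ 0 ∧ ∀ φ : A →ₐ[K] K, φ D ≠ 0 →
      Module.finrank K (formsIn (Ideal.span (Set.range fun i => map (φ₀ : A →+* K) (Q i))) t) ≤
        Module.finrank K (formsIn (Ideal.span (Set.range fun i => map (φ : A →+* K) (Q i))) t) := by
  set J := formsIn (Ideal.span (Set.range fun i => map (φ₀ : A →+* K) (Q i))) t with hJ
  let u := Module.finBasis K J
  have hu (j) : (u j : MvPolynomial (Fin r) K) ∈ J := (u j).2
  choose c hc using fun j => (Ideal.mem_span_range_iff_exists_fun).1 (hu j).2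
  -- The basis elements are lifted to the family by keeping their cofactors constant; passing to the
  -- component of degree `t` keeps the lifts among the forms of degree `t` in the ideal.
  let F (j : Fin (Module.finrank K J)) : MvPolynomial (Fin r) A :=
    homogeneousComponent t (∑ i, map (algebraMap K A) (c j i) * Q i)
  have hmap (φ : A →ₐ[K] K) (j) : map (φ : A →+* K) (F j) =
      homogeneousComponent t (∑ i, c j i * map (φ : A →+* K) (Q i)) := by
    have : (φ : A →+* K).comp (algebraMap K A) = RingHom.id K := by
      ext x; simp
    simp only [F, map_homogeneousComponent, map_sum, map_mul, map_map, this, map_id]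
  have hF₀ : (fun j => map (φ₀ : A →+* K) (F j)) = fun j => (u j : MvPolynomial (Fin r) K) := by
    ext1 j
    rw [hmap, hc, homogeneousComponent_eq_self (hu j).1]
  obtain ⟨D, hD₀, hD⟩ := exists_linearIndependent_of_ne_zero F φ₀ (by
    rw [hF₀]
    exact u.linearIndependent.map' J.subtype (Submodule.ker_subtype J))
  refine ⟨D, hD₀, fun φ hφ => ?_⟩
  have hmem (j) : map (φ : A →+* K) (F j) ∈
      formsIn (Ideal.span (Set.range fun i => map (φ : A →+* K) (Q i))) t := by
    rw [hmap]
    refine ⟨homogeneousComponent_isHomogeneous _ _,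
      homogeneousComponent_mem_span (fun i => (hQ i).map _) ?_ _⟩
    exact Ideal.sum_mem _ fun i _ => Ideal.mul_mem_left _ _ (Ideal.subset_span ⟨i, rfl⟩)
  have hli : LinearIndependent K fun j => (⟨_, hmem j⟩ : formsIn _ t) :=
    LinearIndependent.of_comp (Submodule.subtype _) (hD φ hφ)
  simpa using hli.fintype_card_le_finrank

end Ideals

/-! ### Monomials with quadrics in place of squares -/

section MixedMonomials

/-- The product of the squarefree part of the monomial `x^a` and of the quadrics `q_i` substituted
for the `x_i²` in its square part: `∏ x_i^{a_i mod 2} q_i^{⌊a_i / 2⌋}`. -/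
noncomputable def mixedMonomial {A : Type*} [CommRing A] {r : ℕ}
    (q : Fin (r + 1) → MvPolynomial (Fin r) A) (a : Fin r →₀ ℕ) : MvPolynomial (Fin r) A :=
  ∏ i, (X i ^ (a i % 2) * q i.castSucc ^ (a i / 2))

variable {A : Type*} [CommRing A] {r : ℕ} {q : Fin (r + 1) → MvPolynomial (Fin r) A}

lemma isHomogeneous_mixedMonomial (hq : ∀ i, (q i).IsHomogeneous 2) (a : Fin r →₀ ℕ) :
    (mixedMonomial q a).IsHomogeneous a.degree := by
  rw [Finsupp.degree_eq_sum]
  refine IsHomogeneous.prod _ _ _ fun i _ => ?_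
  have := ((isHomogeneous_X A i).pow (a i % 2)).mul ((hq i.castSucc).pow (a i / 2))
  rwa [one_mul, Nat.mod_add_div] at this

lemma mixedMonomial_add_single (a : Fin r →₀ ℕ) (i : Fin r) :
    mixedMonomial q (a + Finsupp.single i 2) = q i.castSucc * mixedMonomial q a := by
  classical
  have h (j : Fin r) : X j ^ ((a + Finsupp.single i 2 : Fin r →₀ ℕ) j % 2) *
      q j.castSucc ^ ((a + Finsupp.single i 2 : Fin r →₀ ℕ) j / 2) =
      (if j = i then q j.castSucc else 1) * (X j ^ (a j % 2) * q j.castSucc ^ (a j / 2)) := by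
    by_cases hj : j = i
    · subst hj
      simp only [Finsupp.add_apply, Finsupp.single_eq_same, Nat.add_mod_right, if_true,
        Nat.add_div_right _ two_pos, pow_succ]
      ring
    · simp [hj]
  simp only [mixedMonomial, h, Finset.prod_mul_distrib, Finset.prod_ite_eq', Finset.mem_univ,
    if_true]

lemma map_mixedMonomial {B : Type*} [CommRing B] (φ : A →+* B) (a : Fin r →₀ ℕ) :
    map φ (mixedMonomial q a) = mixedMonomial (fun i => map φ (q i)) a := by
  simp [mixedMonomial]

lemma mixedMonomial_specialQuadrics {K : Type*} [Field K] (a : Fin r →₀ ℕ) :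
    mixedMonomial (specialQuadrics K r) a = monomial a 1 := by
  rw [monomial_eq, map_one, one_mul, Finsupp.prod_fintype _ _ fun i => pow_zero _]
  refine Finset.prod_congr rfl fun i _ => ?_
  simp only [specialQuadrics, Fin.snoc_castSucc]
  rw [← pow_mul, ← pow_add, Nat.mod_add_div]

end MixedMonomials

/-! ### The lower bound for the Hilbert function -/

section LowerBound

variable {K : Type*} [Field K] {r : ℕ}

instance (t : ℕ) : Finite {a : Fin r →₀ ℕ // a.degree = t} :=
  (Finsupp.finite_of_degree_eq t).to_subtype

lemma finrank_homogeneousSubmodule (K : Type*) [Field K] (r t : ℕ) :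
    Module.finrank K (homogeneousSubmodule (Fin r) K t) =
      Nat.card {a : Fin r →₀ ℕ // a.degree = t} := by
  classical
  have := Fintype.ofFinite {a : Fin r →₀ ℕ // a.degree = t}
  have hli : LinearIndependent K fun a : {a : Fin r →₀ ℕ // a.degree = t} =>
      (monomial a.1 1 : MvPolynomial (Fin r) K) := by
    have := (basisMonomials (Fin r) K).linearIndependent
    rw [coe_basisMonomials] at this
    exact this.comp _ Subtype.val_injective
  rw [Nat.card_eq_fintype_card, ← finrank_span_eq_card hli]
  suffices h : homogeneousSubmodule (Fin r) K t = Submodule.span K (Set.range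
      fun a : {a : Fin r →₀ ℕ // a.degree = t} => (monomial a.1 1 : MvPolynomial (Fin r) K)) by
    rw [h]
  apply le_antisymm
  · intro f hf
    rw [f.as_sum]
    refine Submodule.sum_mem _ fun a ha => ?_
    rw [← mul_one (coeff a f), ← smul_eq_mul, ← smul_monomial]
    refine Submodule.smul_mem _ _ (Submodule.subset_span ⟨⟨a, ?_⟩, rfl⟩)
    by_contra h
    exact mem_support_iff.1 ha (IsHomogeneous.coeff_eq_zero hf h)
  · rw [Submodule.span_le]
    rintro _ ⟨a, rfl⟩
    exact isHomogeneous_monomial _ a.2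

variable {q : Fin (r + 1) → MvPolynomial (Fin r) K}

lemma homogeneousSubmodule_le_span_mixedMonomial (hq : ∀ i, (q i).IsHomogeneous 2) {t : ℕ}
    (h : LinearIndependent K fun a : {a : Fin r →₀ ℕ // a.degree = t} => mixedMonomial q a.1) :
    homogeneousSubmodule (Fin r) K t ≤
      Submodule.span K (mixedMonomial q '' {a | a.degree = t}) := by
  classical
  have := Fintype.ofFinite {a : Fin r →₀ ℕ // a.degree = t}
  have hrange : mixedMonomial q '' {a | a.degree = t} =
      Set.range fun a : {a : Fin r →₀ ℕ // a.degree = t} => mixedMonomial q a.1 := by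
    ext; simp
  rw [hrange]
  refine (Submodule.eq_of_le_of_finrank_eq ?_ ?_).ge
  · rw [Submodule.span_le]
    rintro _ ⟨a, rfl⟩
    have := isHomogeneous_mixedMonomial hq a.1
    rwa [a.2] at this
  · rw [finrank_homogeneousSubmodule, Nat.card_eq_fintype_card]
    exact finrank_span_eq_card h

lemma ncard_not_squarefree_add (r t : ℕ) :
    {a : Fin r →₀ ℕ | a.degree = t ∧ ∃ i, 2 ≤ a i}.ncard + r.choose t =
      Nat.card {a : Fin r →₀ ℕ // a.degree = t} := by
  have h : (squarefreeExponent '' {S : Finset (Fin r) | S.card = t}).ncard = r.choose t := by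
    rw [Set.ncard_image_of_injective _ squarefreeExponent_injective]
    have : {S : Finset (Fin r) | S.card = t} =
        (Finset.powersetCard t Finset.univ : Finset (Finset (Fin r))) := by
      ext S; simp
    rw [this, Set.ncard_coe_finset, Finset.card_powersetCard, Finset.card_univ, Fintype.card_fin]
  have hfin := Finsupp.finite_of_degree_eq (σ := Fin r) t
  have hsub : squarefreeExponent '' {S : Finset (Fin r) | S.card = t} ⊆ {a | a.degree = t} := by
    rintro _ ⟨S, hS, rfl⟩
    exact (degree_squarefreeExponent S).trans hS
  have hdiff : {a : Fin r →₀ ℕ | a.degree = t ∧ ∃ i, 2 ≤ a i} =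
      {a | a.degree = t} \ (squarefreeExponent '' {S : Finset (Fin r) | S.card = t}) := by
    ext a
    constructor
    · rintro ⟨ha, i, hi⟩
      refine ⟨ha, ?_⟩
      rintro ⟨S, -, rfl⟩
      rw [squarefreeExponent_apply] at hi
      split_ifs at hi <;> omega
    · rintro ⟨ha, hS⟩
      refine ⟨ha, ?_⟩
      by_contra! h'
      obtain ⟨S, rfl⟩ := exists_squarefreeExponent_eq fun i => Nat.le_of_lt_succ (h' i)
      exact hS ⟨S, (degree_squarefreeExponent S).symm.trans ha, rfl⟩
  rw [hdiff, ← h, Set.ncard_sdiff_add_ncard_of_subset hsub hfin]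
  rfl

lemma finrank_span_image_le_ncard {V α : Type*} [AddCommGroup V] [Module K V] (f : α → V)
    {s : Set α} (hs : s.Finite) :
    Module.finrank K (Submodule.span K (f '' s)) ≤ s.ncard := by
  have := (hs.image f).fintype
  refine (finrank_span_le_card (R := K) (f '' s)).trans ?_
  rw [← Set.ncard_eq_toFinset_card']
  exact Set.ncard_image_le hs

/-- Modulo the products of the first `r` quadrics with forms of degree `t - 2`, which lie in the
span of the nonsquarefree mixed monomials, the forms of degree `t` in the ideal are spanned by the
multiples of the last quadric by squarefree monomials. -/
lemma formsIn_le_span_sup_span (hq : ∀ i, (q i).IsHomogeneous 2) {t : ℕ}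
    (h : ∀ u, u + 2 = t → LinearIndependent K
      fun a : {a : Fin r →₀ ℕ // a.degree = u} => mixedMonomial q a.1) :
    formsIn (Ideal.span (Set.range q)) t ≤
      Submodule.span K (mixedMonomial q '' {a | a.degree = t ∧ ∃ i, 2 ≤ a i}) ⊔
      Submodule.span K ((fun S => q (Fin.last r) * mixedMonomial q (squarefreeExponent S)) ''
        {S : Finset (Fin r) | S.card + 2 = t}) := by
  set G := Submodule.span K (mixedMonomial q '' {a | a.degree = t ∧ ∃ i, 2 ≤ a i})
  set H := Submodule.span K ((fun S => q (Fin.last r) * mixedMonomial q (squarefreeExponent S)) ''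
        {S : Finset (Fin r) | S.card + 2 = t})
  have hG (i : Fin r) {u : ℕ} (hu : u + 2 = t) {f : MvPolynomial (Fin r) K}
      (hf : f.IsHomogeneous u) : q i.castSucc * f ∈ G := by
    suffices Submodule.span K (mixedMonomial q '' {a | a.degree = u}) ≤
        G.comap (LinearMap.mulLeft K (q i.castSucc)) from
      this (homogeneousSubmodule_le_span_mixedMonomial hq (h u hu) hf)
    rw [Submodule.span_le]
    rintro _ ⟨a, ha, rfl⟩
    refine Submodule.subset_span ⟨a + Finsupp.single i 2, ⟨?_, i, by simp⟩,
      mixedMonomial_add_single a i⟩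
    rw [map_add, Finsupp.degree_single, ← hu, show a.degree = u from ha]
  have hH {u : ℕ} (hu : u + 2 = t) {f : MvPolynomial (Fin r) K}
      (hf : f.IsHomogeneous u) : q (Fin.last r) * f ∈ G ⊔ H := by
    suffices Submodule.span K (mixedMonomial q '' {a | a.degree = u}) ≤
        (G ⊔ H).comap (LinearMap.mulLeft K (q (Fin.last r))) from
      this (homogeneousSubmodule_le_span_mixedMonomial hq (h u hu) hf)
    rw [Submodule.span_le]
    rintro _ ⟨a, ha, rfl⟩
    replace ha : a.degree = u := ha
    by_cases hs : ∃ i, 2 ≤ a i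
    · obtain ⟨i, hi⟩ := hs
      obtain ⟨b, rfl⟩ : ∃ b, a = b + Finsupp.single i 2 :=
        ⟨a - Finsupp.single i 2, (tsub_add_cancel_of_le (by simpa using hi)).symm⟩
      rw [map_add, Finsupp.degree_single] at ha
      -- A nonsquarefree mixed monomial has a factor `q_i` with `i ≤ r`; the last quadric times the
      -- remaining factor is a form of degree `u`, to which `hG` applies.
      have := hG i hu (f := q (Fin.last r) * mixedMonomial q b) (by
        rw [← ha, add_comm]
        exact (hq _).mul (isHomogeneous_mixedMonomial hq b))
      refine Submodule.mem_sup_left ?_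
      rw [LinearMap.mulLeft_apply, mixedMonomial_add_single]
      convert this using 1
      ring
    · push Not at hs
      obtain ⟨S, rfl⟩ := exists_squarefreeExponent_eq fun i => Nat.le_of_lt_succ (hs i)
      refine Submodule.mem_sup_right (Submodule.subset_span ⟨S, ?_, rfl⟩)
      rw [degree_squarefreeExponent] at ha
      exact (congrArg (· + 2) ha).trans hu
  intro f hf
  obtain ⟨c, hc, rfl⟩ := exists_eq_sum_of_mem_formsIn hq hf
  refine Submodule.sum_mem _ fun i _ => ?_
  rcases hc i with h0 | ⟨u, hu, hcu⟩
  · rw [h0, zero_mul]; exact Submodule.zero_mem _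
  · rw [mul_comm]
    refine Fin.lastCases (motive := fun i => (c i).IsHomogeneous u → q i * c i ∈ G ⊔ H)
      (fun hl => hH hu hl) (fun j hj => Submodule.mem_sup_left (hG j hu hj)) i hcu

/-- The lower bound for the Hilbert function of `r + 1` quadrics, valid as soon as the mixed
monomials of degree `t - 2` are linearly independent. -/
theorem binom_sub_binom_le_finrank_gradedComponent (hq : ∀ i, (q i).IsHomogeneous 2) {t : ℕ}
    (h : ∀ u, u + 2 = t → LinearIndependent K
      fun a : {a : Fin r →₀ ℕ // a.degree = u} => mixedMonomial q a.1) :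
    binom r t - binom r (t - 2) ≤
      Module.finrank K (gradedComponent (Ideal.span (Set.range q)) t) := by
  have h1 := finrank_gradedComponent_add (Ideal.span (Set.range q)) t
  have h2 := ncard_not_squarefree_add r t
  rw [← finrank_homogeneousSubmodule K] at h2
  have hfin1 : {a : Fin r →₀ ℕ | a.degree = t ∧ ∃ i, 2 ≤ a i}.Finite :=
    (Finsupp.finite_of_degree_eq t).subset fun a ha => ha.1
  have hfin2 : {S : Finset (Fin r) | S.card + 2 = t}.Finite := Set.toFinite _
  have := FiniteDimensional.span_of_finite K (hfin1.image (mixedMonomial q))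
  have := FiniteDimensional.span_of_finite K (hfin2.image
    fun S => q (Fin.last r) * mixedMonomial q (squarefreeExponent S))
  have h3 := (Submodule.finrank_mono (formsIn_le_span_sup_span hq h)).trans
    (Submodule.finrank_add_le_finrank_add_finrank _ _)
  have h4 := finrank_span_image_le_ncard (K := K) (mixedMonomial q) hfin1
  have h5 := finrank_span_image_le_ncard (K := K)
    (fun S => q (Fin.last r) * mixedMonomial q (squarefreeExponent S)) hfin2
  have h6 : ({S : Finset (Fin r) | S.card + 2 = t}.ncard : ℤ) = binom r (t - 2) := by
    by_cases ht : t < 2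
    · have : {S : Finset (Fin r) | S.card + 2 = t} = ∅ := by
        exact Set.eq_empty_of_forall_notMem fun S (hS : S.card + 2 = t) => by omega
      rw [this, Set.ncard_empty, binom, if_neg (by omega), Nat.cast_zero]
    · obtain ⟨s, rfl⟩ := Nat.exists_eq_add_of_le' (not_lt.1 ht)
      have : {S : Finset (Fin r) | S.card + 2 = s + 2} =
        (Finset.powersetCard s Finset.univ : Finset (Finset (Fin r))) := by
        ext S; simp
      rw [this, Set.ncard_coe_finset, Finset.card_powersetCard, Finset.card_univ, Fintype.card_fin,
        show ((s + 2 : ℕ) : ℤ) - 2 = s by push_cast; ring]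
      simp [binom]
  have hb : binom r t = r.choose t := by simp [binom]
  rw [← h6, hb]
  omega

end LowerBound

/-! ### Vanishing in high degrees -/

section Finiteness

variable {K : Type*} [Field K] {r : ℕ}

lemma homogeneousSubmodule_le_of_le {I : Ideal (MvPolynomial (Fin r) K)} {n : ℕ}
    (h : homogeneousSubmodule (Fin r) K n ≤ I.restrictScalars K) {t : ℕ} (ht : n ≤ t) :
    homogeneousSubmodule (Fin r) K t ≤ I.restrictScalars K := by
  induction t, ht using Nat.le_induction with
  | base => exact h
  | succ t _ ih =>
    intro f hf
    rw [f.as_sum]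
    refine Submodule.sum_mem _ fun a ha => ?_
    have hdeg : a.degree = t + 1 := by
      by_contra h'
      exact mem_support_iff.1 ha (IsHomogeneous.coeff_eq_zero hf h')
    obtain ⟨i, hi⟩ : ∃ i, a i ≠ 0 := by
      by_contra! h'
      rw [show a = 0 from Finsupp.ext h', map_zero] at hdeg
      omega
    obtain ⟨b, rfl⟩ : ∃ b, a = Finsupp.single i 1 + b :=
      ⟨a - Finsupp.single i 1,
        (add_tsub_cancel_of_le (by simpa using Nat.one_le_iff_ne_zero.2 hi)).symm⟩
    rw [map_add, Finsupp.degree_single] at hdeg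
    rw [← one_mul (coeff _ f), ← monomial_mul]
    exact Ideal.mul_mem_left I _ (ih (isHomogeneous_monomial _ (by omega)))

lemma gradedComponent_eq_bot_iff {I : Ideal (MvPolynomial (Fin r) K)} {t : ℕ} :
    gradedComponent I t = ⊥ ↔ homogeneousSubmodule (Fin r) K t ≤ I.restrictScalars K := by
  rw [gradedComponent, restrictScalars_eq_ker_mk]
  exact LinearMap.le_ker_iff_map.symm

lemma isArtinianRing_quotient {I : Ideal (MvPolynomial (Fin r) K)} {n : ℕ}
    (h : homogeneousSubmodule (Fin r) K n ≤ I.restrictScalars K) :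
    IsArtinianRing (MvPolynomial (Fin r) K ⧸ I) := by
  have : Module.Finite K (MvPolynomial (Fin r) K ⧸ I) := by
    rw [Module.finite_def, Submodule.fg_def]
    refine ⟨(fun a => Ideal.Quotient.mkₐ K I (monomial a 1)) '' {a | a.degree < n},
      (Finsupp.finite_of_degree_lt n).image _, ?_⟩
    rw [eq_top_iff]
    intro x _
    obtain ⟨f, rfl⟩ := Ideal.Quotient.mkₐ_surjective K I x
    rw [f.as_sum, map_sum]
    refine Submodule.sum_mem _ fun a _ => ?_
    by_cases ha : a.degree < n
    · rw [← mul_one (coeff a f), ← smul_eq_mul, ← smul_monomial, map_smul]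
      exact Submodule.smul_mem _ _ (Submodule.subset_span ⟨a, ha, rfl⟩)
    · have : monomial a (coeff a f) ∈ I :=
        homogeneousSubmodule_le_of_le h (not_lt.1 ha) (isHomogeneous_monomial _ rfl)
      rw [Ideal.Quotient.mkₐ_eq_mk, Ideal.Quotient.eq_zero_iff_mem.2 this]
      exact Submodule.zero_mem _
  exact IsArtinianRing.of_finite K _

lemma binom_nonneg (r : ℕ) (t : ℤ) : 0 ≤ binom r t := by
  unfold binom; split_ifs <;> positivity

end Finiteness

/-! ### Families of quadrics -/

section Families

variable {K : Type*} [Field K] {r : ℕ}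

/-- The `i`-th member of the universal `s`-tuple of forms of degree `d`, whose coefficients are
independent variables. -/
noncomputable def genericForm (K : Type*) [Field K] (r d : ℕ) {s : ℕ} (i : Fin s) :
    MvPolynomial (Fin r) (MvPolynomial (Fin s × (Fin r →₀ ℕ)) K) :=
  ∑ a ∈ (Finsupp.finite_of_degree_eq (σ := Fin r) d).toFinset, monomial a (X (i, a))

lemma isHomogeneous_genericForm (d : ℕ) {s : ℕ} (i : Fin s) :
    (genericForm K r d i).IsHomogeneous d :=
  IsHomogeneous.sum _ _ _ fun a ha => isHomogeneous_monomial _ (by simpa using ha)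

lemma map_genericForm {d s : ℕ} (f : Fin s → Form K r d) (i : Fin s) :
    map (aeval (R := K) (coords f) : MvPolynomial (Fin s × (Fin r →₀ ℕ)) K →+* K)
      (genericForm K r d i) = f i := by
  classical
  ext a
  simp only [genericForm, map_sum, map_monomial, coeff_sum, coeff_monomial]
  rw [Finset.sum_ite_eq']
  split_ifs with ha
  · simp [coords]
  · exact (IsHomogeneous.coeff_eq_zero (f i).2 (by simpa using ha)).symm

variable [CharZero K]

/-- In a family of `r + 1` quadrics passing through the special point, the members away from the
zero set of some function that does not vanish there have the expected Hilbert function. Degrees up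
to `r + 1` suffice: there the expected dimension is already zero. -/
theorem exists_hilbertFunction_eq_of_ne_zero {A : Type*} [CommRing A] [Algebra K A]
    {Q : Fin (r + 1) → MvPolynomial (Fin r) A} (hQ : ∀ i, (Q i).IsHomogeneous 2) (φ₀ : A →ₐ[K] K)
    (hφ₀ : ∀ i, map (φ₀ : A →+* K) (Q i) = specialQuadrics K r i) :
    ∃ D : A, φ₀ D ≠ 0 ∧ ∀ φ : A →ₐ[K] K, φ D ≠ 0 → ∀ I : Ideal (MvPolynomial (Fin r) K),
      I = Ideal.span (Set.range fun i => map (φ : A →+* K) (Q i)) →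
      IsArtinianRing (MvPolynomial (Fin r) K ⧸ I) ∧
      ∀ t : ℤ, hilbertFunction I t = max (binom r t - binom r (t - 2)) 0 := by
  choose D₁ hD₁₀ hD₁ using fun t : ℕ => exists_linearIndependent_of_ne_zero
    (fun a : {a : Fin r →₀ ℕ // a.degree = t} => mixedMonomial Q a.1) φ₀ (by
      have := (basisMonomials (Fin r) K).linearIndependent
      rw [coe_basisMonomials] at this
      simp only [map_mixedMonomial, hφ₀, mixedMonomial_specialQuadrics]
      exact this.comp _ Subtype.val_injective)
  choose D₂ hD₂₀ hD₂ using fun t : ℕ => exists_finrank_formsIn_le_of_ne_zero hQ φ₀ t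
  refine ⟨∏ t ∈ Finset.range (r + 2), (D₁ t * D₂ t), ?_, ?_⟩
  · rw [map_prod, Finset.prod_ne_zero_iff]
    intro t _
    rw [map_mul]
    exact mul_ne_zero (hD₁₀ t) (hD₂₀ t)
  rintro φ hφ I rfl
  rw [map_prod, Finset.prod_ne_zero_iff] at hφ
  simp only [map_mul, mul_ne_zero_iff, Finset.mem_range] at hφ
  set I := Ideal.span (Set.range fun i => map (φ : A →+* K) (Q i)) with hI
  have hsmall (t : ℕ) (ht : t < r + 2) :
      (Module.finrank K (gradedComponent I t) : ℤ) = max (binom r t - binom r (t - 2)) 0 := by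
    apply le_antisymm
    · have h1 := hD₂ t φ (hφ t ht).2
      rw [show (fun i => map (φ₀ : A →+* K) (Q i)) = specialQuadrics K r from funext hφ₀, ← hI] at h1
      have h2 := finrank_le_finrank_formsIn_specialQuadrics (K := K) (r := r) t
      have h3 := finrank_gradedComponent_add I t
      omega
    · refine max_le ?_ (Nat.cast_nonneg _)
      refine binom_sub_binom_le_finrank_gradedComponent (fun i => (hQ i).map _) fun u hu => ?_
      have := hD₁ u φ (hφ u (by omega)).1
      simpa only [map_mixedMonomial] using this
  have hzero (t : ℕ) (ht : r < t) : max (binom r t - binom r (t - 2)) 0 = 0 := by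
    have h1 : binom r t = 0 := by simp [binom, Nat.choose_eq_zero_of_lt ht]
    have h2 := binom_nonneg r (t - 2)
    omega
  have hvanish : homogeneousSubmodule (Fin r) K (r + 1) ≤ I.restrictScalars K := by
    have : FiniteDimensional K (gradedComponent I (r + 1)) :=
      Module.Finite.map (homogeneousSubmodule (Fin r) K (r + 1)) _
    rw [← gradedComponent_eq_bot_iff, ← Submodule.finrank_eq_zero (R := K)]
    have := hsmall (r + 1) (by omega)
    rw [hzero (r + 1) (by omega)] at this
    exact_mod_cast this
  refine ⟨isArtinianRing_quotient hvanish, fun t => ?_⟩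
  unfold hilbertFunction
  split_ifs with ht
  · lift t to ℕ using ht
    rw [Int.toNat_natCast]
    by_cases htr : t < r + 2
    · exact hsmall t htr
    · rw [hzero t (by omega), gradedComponent_eq_bot_iff.2
        (homogeneousSubmodule_le_of_le hvanish (by omega)), finrank_bot, Nat.cast_zero]
  · rw [binom, binom, if_neg ht, if_neg (by omega), sub_zero, max_self]

/-- A family of quadrics parametrised by tuples of forms yields a non-empty open set of such tuples with
the expected Hilbert function, as soon as the special point occurs in the family. -/
theorem exists_isZariskiOpen {d s : ℕ}
    {Q : Fin (r + 1) → MvPolynomial (Fin r) (MvPolynomial (Fin s × (Fin r →₀ ℕ)) K)}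
    (hQ : ∀ i, (Q i).IsHomogeneous 2) (f₀ : Fin s → Form K r d)
    (hf₀ : ∀ i, map (aeval (R := K) (coords f₀) : MvPolynomial (Fin s × (Fin r →₀ ℕ)) K →+* K)
      (Q i) = specialQuadrics K r i) :
    ∃ U : Set (Fin s → Form K r d), (IsZariskiOpen U ∧ U.Nonempty) ∧
      ∀ f ∈ U, ∀ I : Ideal (MvPolynomial (Fin r) K), I = Ideal.span (Set.range fun i =>
        map (aeval (R := K) (coords f) : MvPolynomial (Fin s × (Fin r →₀ ℕ)) K →+* K) (Q i)) →
      IsArtinianRing (MvPolynomial (Fin r) K ⧸ I) ∧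
      ∀ t : ℤ, hilbertFunction I t = max (binom r t - binom r (t - 2)) 0 := by
  obtain ⟨D, hD₀, hD⟩ := exists_hilbertFunction_eq_of_ne_zero hQ (aeval (coords f₀)) hf₀
  refine ⟨{f | ∃ D' ∈ ({D} : Set _), eval (coords f) D' ≠ 0}, ⟨⟨{D}, rfl⟩, f₀, D, rfl, ?_⟩, ?_⟩
  · rwa [← coe_aeval_eq_eval]
  · rintro f ⟨_, rfl, hf⟩
    exact hD _ (by rwa [← coe_aeval_eq_eval] at hf)

end Families

end GeneralForms

open GeneralForms in
theorem lemma3 (K : Type*) [Field K] [IsAlgClosed K] [CharZero K] (r : ℕ) :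
    ∃ (UA : Set (Fin 1 → GeneralForms.Form K r 1))
      (UB : Set (Fin (r + 1) → GeneralForms.Form K r 1))
      (UC : Set (Fin (r + 1) → GeneralForms.Form K r 2)),
      (GeneralForms.IsZariskiOpen UA ∧ UA.Nonempty) ∧
      (GeneralForms.IsZariskiOpen UB ∧ UB.Nonempty) ∧
      (GeneralForms.IsZariskiOpen UC ∧ UC.Nonempty) ∧
      ∀ l ∈ UA, ∀ ls ∈ UB, ∀ qs ∈ UC,
        IsArtinianRing (MvPolynomial (Fin r) K ⧸ GeneralForms.idealA (l 0)) ∧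
        IsArtinianRing (MvPolynomial (Fin r) K ⧸ GeneralForms.idealB ls) ∧
        IsArtinianRing (MvPolynomial (Fin r) K ⧸ GeneralForms.idealC qs) ∧
        ∀ t : ℤ,
          GeneralForms.hilbertFunction (GeneralForms.idealA (l 0)) t =
            GeneralForms.hilbertFunction (GeneralForms.idealB ls) t ∧
          GeneralForms.hilbertFunction (GeneralForms.idealB ls) t =
            GeneralForms.hilbertFunction (GeneralForms.idealC qs) t ∧
          GeneralForms.hilbertFunction (GeneralForms.idealA (l 0)) t =
            max (GeneralForms.binom r t - GeneralForms.binom r (t - 2)) 0 := by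
  have hsum : (∑ i, X i : MvPolynomial (Fin r) K).IsHomogeneous 1 :=
    IsHomogeneous.sum _ _ 1 fun i _ => isHomogeneous_X K i
  obtain ⟨UA, hUA, hA⟩ := exists_isZariskiOpen (K := K) (r := r)
    (Q := Fin.snoc (fun i => X i ^ 2) (genericForm K r 1 (0 : Fin 1) ^ 2))
    (fun i => by
      refine Fin.lastCases ?_ (fun i => ?_) i
      · simpa only [Fin.snoc_last] using (isHomogeneous_genericForm 1 (0 : Fin 1)).pow 2
      · simpa only [Fin.snoc_castSucc] using isHomogeneous_X_pow i 2)
    (fun _ => ⟨∑ i, X i, hsum⟩)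
    (fun i => by
      refine Fin.lastCases ?_ (fun i => ?_) i
      · simp only [Fin.snoc_last, map_pow, map_genericForm, specialQuadrics]
      · simp only [Fin.snoc_castSucc, map_pow, map_X, specialQuadrics])
  obtain ⟨UB, hUB, hB⟩ := exists_isZariskiOpen (K := K) (r := r)
    (Q := fun i => genericForm K r 1 i ^ 2)
    (fun i => (isHomogeneous_genericForm 1 i).pow 2)
    (Fin.snoc (fun i => ⟨X i, isHomogeneous_X K i⟩) ⟨∑ i, X i, hsum⟩)
    (fun i => by
      rw [map_pow, map_genericForm]
      refine Fin.lastCases ?_ (fun i => ?_) i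
      · simp only [Fin.snoc_last, specialQuadrics]
      · simp only [Fin.snoc_castSucc, specialQuadrics])
  obtain ⟨UC, hUC, hC⟩ := exists_isZariskiOpen (K := K) (r := r)
    (Q := fun i => genericForm K r 2 i) (fun i => isHomogeneous_genericForm 2 i)
    (Fin.snoc (fun i => ⟨X i ^ 2, isHomogeneous_X_pow i 2⟩) ⟨(∑ i, X i) ^ 2, hsum.pow 2⟩)
    (fun i => by
      rw [map_genericForm]
      refine Fin.lastCases ?_ (fun i => ?_) i
      · simp only [Fin.snoc_last, specialQuadrics]
      · simp only [Fin.snoc_castSucc, specialQuadrics])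
  refine ⟨UA, UB, UC, hUA, hUB, hUC, fun l hl ls hls qs hqs => ?_⟩
  obtain ⟨artA, hilbA⟩ := hA l hl (idealA (l 0)) (by
    unfold idealA
    congr 1
    ext f
    simp only [Set.mem_union, Set.mem_range, Set.mem_singleton_iff, Fin.exists_fin_succ',
      Fin.snoc_castSucc, Fin.snoc_last, map_pow, map_X, map_genericForm]
    rw [eq_comm (a := f)])
  obtain ⟨artB, hilbB⟩ := hB ls hls (idealB ls) (by simp only [idealB, map_pow, map_genericForm])
  obtain ⟨artC, hilbC⟩ := hC qs hqs (idealC qs) (by simp only [idealC, map_genericForm])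
  exact ⟨artA, artB, artC, fun t => ⟨(hilbA t).trans (hilbB t).symm,
    (hilbB t).trans (hilbC t).symm, hilbA t⟩⟩
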